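/- Let $\mathcal S=\mathbb R/2\pi\mathbb Z$, and for $\theta\in\mathcal S$ let $\tilde\theta\in(-\pi,\pi]$ be its representative. For $J\in\mathbb R$, $\sigma>0$ and $N\in\mathbb N$ let $\mu=\mu_{N,J,\sigma}$ be the probability measure on $\mathcal S^N$ whose density with respect to Lebesgue measure is proportional to $$\exp\Big(\frac{J}{2\sigma^2}\sum_{i=1}^N\cos(x_i-x_{i-1})\Big),\qquad x_0:=x_N .$$ Let $w(x)=\frac1{2\pi}\sum_{i=1}^N\widetilde{x_i-x_{i-1}}$ be the winding number, defined whenever $x_i-x_{i-1}\ne\pi$ for all $i$. (The event $\{w=k\}$ consists of the $x$ for which $w(x)$ is defined and equal to $k$.) Let $h(x)=\frac1m e^{\frac{J}{2\sigma^2}\cos x}$, with $m=\int_{\mathcal S} e^{\frac{J}{2\sigma^2}\cos x}\,dx$, be the increment density on $\mathcal S$. For a random point $\xi$ of $\mathcal S$ with density $h$, let $g=g_{J,\sigma}$ be the density on $\mathbb R$ of $\tilde\xi/2\pi$, that is, $g(y)=2\pi h(2\pi y)$ for $y\in(-\frac12,\frac12]$ and $g(y)=0$ otherwise. Let $g^{\star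 M}$ be the $M$-fold convolution of $g$ with itself on $\mathbb R$. **Proposition.** For every $k\in\mathbb Z$ there exist constants $c,C>0$, not depending on $J,\sigma$, such that the following holds. Let $(J_N)_N$ be a sequence of real numbers and $(\sigma_N)_N$ a sequence of positive real numbers with $J_N/\sigma_N^2\to\infty$ and $J_N/\sigma_N^2=o(N)$ as $N\to\infty$. Then, for all $N$ large enough, with $J=J_N$, $\sigma=\sigma_N$, $g=g_{J,\sigma}$ and $\mu=\mu_{N,J,\sigma}$: for all integers $M\ge N/2$ and all $y\in[k-1,k+1]$, $$c\,\frac{\sqrt J}{\sigma}M^{-1/2}\le g^{\star M}(y)\le C\,\frac{\sqrt J}{\sigma}M^{-1/2},$$ and moreover $$c\,\frac{\sqrt J}{\sigma}N^{-1/2}\le \mu(w=k)\le C\,\frac{\sqrt J}{\sigma}N^{-1/2}.$$ -/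

import Mathlib

open MeasureTheory Filter Topology Set Asymptotics

namespace RotorChain

noncomputable section

instance factTwoPiPos : Fact (0 < 2 * Real.pi) := ⟨Real.two_pi_pos⟩

/-- The one-dimensional torus `ℝ / 2πℤ`; its `volume` is Lebesgue measure, of total mass `2π`. -/
abbrev Torus : Type := AddCircle (2 * Real.pi)

/-- The cosine as a function on the torus. -/
def cosT : Torus → ℝ := Real.cos_periodic.lift

/-- The representative in `(-π, π]` of a point of the torus. -/
def rep (θ : Torus) : ℝ := (AddCircle.equivIoc (2 * Real.pi) (-Real.pi) θ : ℝ)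

/-- The increment `x_i - x_{i-1}` of a configuration, with the cyclic convention `x_0 = x_N`. -/
def incr {N : ℕ} (x : Fin N → Torus) (i : Fin N) : Torus := x i - x ((finRotate N).symm i)

/-- The Hamiltonian `H_N(x) = -J ∑ cos (x_i - x_{i-1})`. -/
def hamiltonian (J : ℝ) {N : ℕ} (x : Fin N → Torus) : ℝ := -J * ∑ i, cosT (incr x i)

/-- The equilibrium (Gibbs) measure, the probability measure on `Torus ^ N` with density
`exp (-H_N / (2 σ²)) / Z_N` with respect to Lebesgue measure. -/
def gibbs (J σ : ℝ) (N : ℕ) : Measure (Fin N → Torus) :=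
  (volume : Measure (Fin N → Torus)).tilted (fun x => -(1 / (2 * σ ^ 2)) * hamiltonian J x)

/-- The event that the winding number `(2π)⁻¹ ∑ rep (x_i - x_{i-1})` is defined
(no increment is equal to `π`) and is equal to `k`. -/
def windingEq (N : ℕ) (k : ℤ) : Set (Fin N → Torus) :=
  {x | (∀ i, incr x i ≠ ((Real.pi : ℝ) : Torus)) ∧
    1 / (2 * Real.pi) * ∑ i, rep (incr x i) = (k : ℝ)}

/-- The normalization `m = ∫ exp (J / (2σ²) cos x) dx` over the torus. -/
def normConst (J σ : ℝ) : ℝ := ∫ x : Torus, Real.exp (J / (2 * σ ^ 2) * cosT x)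

/-- The increment density `h(x) = exp (J / (2σ²) cos x) / m` on the torus. -/
def stepDensity (J σ : ℝ) (x : Torus) : ℝ :=
  1 / normConst J σ * Real.exp (J / (2 * σ ^ 2) * cosT x)

/-- The density `g` on `ℝ` of `ρ / 2π`, where `ρ` is the representative in `(-π, π]` of a random
point of the torus with density `h` (see `map_rep_eq_withDensity`). -/
def g (J σ : ℝ) : ℝ → ℝ :=
  (Ioc (-(1 / 2)) (1 / 2) : Set ℝ).indicator
    fun y => 2 * Real.pi * stepDensity J σ ((2 * Real.pi * y : ℝ) : Torus)

/-- The `M`-fold convolution `f ⋆ ⋯ ⋆ f` on `ℝ` (with `M ≥ 1` factors; the value at `M = 0`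
is a placeholder). -/
def convPow (f : ℝ → ℝ) : ℕ → ℝ → ℝ
  | 0 => 0
  | 1 => f
  | n + 2 => convolution (convPow f (n + 1)) f (ContinuousLinearMap.mul ℝ ℝ) volume

lemma cosT_coe (a : ℝ) : cosT (a : Torus) = Real.cos a := rfl

lemma continuous_cosT : Continuous cosT :=
  continuous_coinduced_dom.mpr Real.continuous_cos

lemma rep_coe {a : ℝ} (ha : a ∈ Ioc (-Real.pi) Real.pi) : rep (a : Torus) = a := by
  have ha' : a ∈ Ioc (-Real.pi) (-Real.pi + 2 * Real.pi) := by
    constructor <;> linarith [ha.1, ha.2]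
  unfold rep
  rw [AddCircle.equivIoc_coe_eq ha']

lemma measurable_rep : Measurable rep :=
  measurable_subtype_coe.comp (AddCircle.measurableEquivIoc (2 * Real.pi) (-Real.pi)).measurable

lemma continuous_stepDensity (J σ : ℝ) : Continuous (stepDensity J σ) := by
  have := continuous_cosT
  unfold stepDensity
  fun_prop

/-- `g` is the density of `ρ / 2π`. -/
lemma map_rep_eq_withDensity (J σ : ℝ) :
    Measure.map (fun θ : Torus => rep θ / (2 * Real.pi))
        ((volume : Measure Torus).withDensity fun θ => ENNReal.ofReal (stepDensity J σ θ)) =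
      (volume : Measure ℝ).withDensity fun y => ENNReal.ofReal (g J σ y) := by
  have hpi := Real.pi_pos
  have hm : Measurable fun θ : Torus => rep θ / (2 * Real.pi) := measurable_rep.div_const _
  ext s hs
  rw [Measure.map_apply hm hs, withDensity_apply _ (hm hs), withDensity_apply _ hs,
    ← lintegral_indicator (hm hs), ← lintegral_indicator hs,
    ← AddCircle.lintegral_preimage (2 * Real.pi) (-Real.pi), ← lintegral_indicator measurableSet_Ioc]
  have key := Real.smul_map_volume_mul_left (a := 2 * Real.pi) (by positivity)
  have hme : MeasurableEmbedding fun x : ℝ => 2 * Real.pi * x :=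
    (Homeomorph.mulLeft₀ (2 * Real.pi) (by positivity)).measurableEmbedding
  conv_lhs => rw [← key, lintegral_smul_measure, hme.lintegral_map]
  rw [smul_eq_mul, ← lintegral_const_mul' _ _ ENNReal.ofReal_ne_top]
  refine lintegral_congr fun y => ?_
  have hmem : (2 * Real.pi * y ∈ Ioc (-Real.pi) (-Real.pi + 2 * Real.pi)) ↔
      y ∈ Ioc (-(1 / 2 : ℝ)) (1 / 2) := by
    constructor
    · rintro ⟨h1, h2⟩; constructor <;> nlinarith
    · rintro ⟨h1, h2⟩; constructor <;> nlinarith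
  have hab : |2 * Real.pi| = 2 * Real.pi := abs_of_pos (by positivity)
  by_cases hy : y ∈ Ioc (-(1 / 2 : ℝ)) (1 / 2)
  · have hy' : 2 * Real.pi * y ∈ Ioc (-Real.pi) Real.pi := by
      have := hmem.2 hy
      constructor <;> linarith [this.1, this.2]
    have hr : rep ((2 * Real.pi * y : ℝ) : Torus) / (2 * Real.pi) = y := by
      rw [rep_coe hy']; field_simp
    rw [indicator_of_mem (hmem.2 hy)]
    by_cases hys : y ∈ s
    · rw [indicator_of_mem (by simpa [hr] using hys), indicator_of_mem hys, g,
        indicator_of_mem hy, hab,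
        ENNReal.ofReal_mul (p := 2 * Real.pi) (by positivity)]
    · rw [indicator_of_notMem (by simpa [hr] using hys), indicator_of_notMem hys, mul_zero]
  · rw [indicator_of_notMem (fun h => hy (hmem.1 h)), mul_zero]
    by_cases hys : y ∈ s
    · rw [indicator_of_mem hys, g, indicator_of_notMem hy, ENNReal.ofReal_zero]
    · rw [indicator_of_notMem hys]

instance isProbabilityMeasure_gibbs (J σ : ℝ) (N : ℕ) : IsProbabilityMeasure (gibbs J σ N) := by
  refine isProbabilityMeasure_tilted ?_
  refine Continuous.integrable_of_hasCompactSupport ?_ (HasCompactSupport.of_compactSpace _)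
  have := continuous_cosT
  unfold hamiltonian incr
  fun_prop

end

end RotorChain

/-!
Write `b = J / (2σ²)`, and let `φ(t) = E cos (tθ)` be the characteristic function of the von Mises
density `h ∝ exp (b cos θ)` on `(-π, π]`, so that the Fourier transform of `g` is `φ`. Both
estimates rest on two bounds on `φ` at real `t` that are uniform in `b ≥ 3`:

* `charFn_sq_le`: `φ(t)² ≤ 1 / (1 + t² / (13 b))`. It comes from an integration by parts,
  `t φ(t) = b E[sin θ sin (tθ)] + 2 h(π) sin (πt)`, the Cauchy–Schwarz inequality and
  `b E sin² θ = E cos θ ≤ 1`.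
* `one_sub_le_charFn`: `φ(t) ≥ 1 - 15 t² / b`, which is a bound on the variance of `h`.

By Bernoulli's inequality, the first bound gives `|φ(t)^M| ≤ 1 / (1 + M t² / (26 b))`, a Lorentzian
of width of order `√(b / M)`. For `M ≥ 2` the function `g^{⋆ M}` is continuous, so
`g^{⋆ M}(y) = ∫ cos (2πty) φ(t)^M dt`. Integrating the Lorentzian gives the upper bound
(`convPow_le`). For the lower bound (`le_convPow`), the integrand is nonnegative for
`|t| ≤ T √(b / M)`, at least `1/4` for `|t| ≤ √(b / M) / 6`, and the part of the integral where
`|t| > T √(b / M)` is at most a constant times `√(b / M) / T`; a large constant `T` makes it smaller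
than the contribution of the centre.

For the winding number, integrate out the points of the closed chain one by one. This shows that
the unnormalized weight of the configurations with winding number `k` is `g^{⋆ N}(k)`
(`lintegral_winding`), hence `μ(w = k) = g^{⋆ N}(k) / ∑ j, g^{⋆ N}(j)` (`gibbs_real_windingEq`). By
Poisson summation the denominator is `∑ n, φ(n)^N`, whose term `n = 0` is `1` and whose other terms
add up to `O(b / N)` (`exists_abs_tsum_convPow_sub_one_le`), which is small as `b = o(N)`.
-/

open scoped FourierTransform

namespace RotorChain

noncomputable section

/-! ### The characteristic function of the von Mises distribution -/

/-- The unnormalized von Mises expectation `∫ f(θ) exp (b cos θ) dθ` over `[-π, π]`. -/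
def vonMises (b : ℝ) (f : ℝ → ℝ) : ℝ :=
  ∫ x in (-Real.pi)..Real.pi, f x * Real.exp (b * Real.cos x)

/-- The characteristic function `t ↦ E cos (t θ)` of the von Mises distribution, at real `t`. -/
def charFn (b t : ℝ) : ℝ :=
  vonMises b (fun x => Real.cos (t * x)) / vonMises b (fun _ => 1)

lemma intervalIntegrable_vonMises (b : ℝ) {f : ℝ → ℝ} (hf : Continuous f) (u v : ℝ) :
    IntervalIntegrable (fun x => f x * Real.exp (b * Real.cos x)) volume u v :=
  Continuous.intervalIntegrable (by fun_prop) _ _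

lemma vonMises_mono (b : ℝ) {f f' : ℝ → ℝ} (hf : Continuous f) (hf' : Continuous f')
    (h : ∀ x ∈ Icc (-Real.pi) Real.pi, f x ≤ f' x) : vonMises b f ≤ vonMises b f' := by
  refine intervalIntegral.integral_mono_on (by linarith [Real.pi_pos])
    (intervalIntegrable_vonMises b hf _ _) (intervalIntegrable_vonMises b hf' _ _) fun x hx => ?_
  exact mul_le_mul_of_nonneg_right (h x hx) (Real.exp_pos _).le

lemma vonMises_add (b : ℝ) {f f' : ℝ → ℝ} (hf : Continuous f) (hf' : Continuous f') :
    vonMises b (fun x => f x + f' x) = vonMises b f + vonMises b f' := by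
  unfold vonMises
  rw [← intervalIntegral.integral_add (intervalIntegrable_vonMises b hf _ _)
    (intervalIntegrable_vonMises b hf' _ _)]
  simp only [add_mul]

lemma vonMises_const_mul (b c : ℝ) (f : ℝ → ℝ) :
    vonMises b (fun x => c * f x) = c * vonMises b f := by
  unfold vonMises
  rw [← intervalIntegral.integral_const_mul]
  simp only [mul_assoc]

lemma vonMises_nonneg (b : ℝ) {f : ℝ → ℝ} (h : ∀ x, 0 ≤ f x) : 0 ≤ vonMises b f :=
  intervalIntegral.integral_nonneg (by linarith [Real.pi_pos])
    fun x _ => mul_nonneg (h x) (Real.exp_pos _).le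

/-- By `1 + x ≤ exp x`, since `cos` has mean zero. -/
lemma two_pi_le_vonMises_one (b : ℝ) : 2 * Real.pi ≤ vonMises b (fun _ => 1) := by
  have h : ∫ x in (-Real.pi)..Real.pi, (1 + b * Real.cos x) = 2 * Real.pi := by
    rw [intervalIntegral.integral_add (by simp)
      (Continuous.intervalIntegrable (by fun_prop) _ _)]
    simp
    ring
  rw [← h]
  unfold vonMises
  refine intervalIntegral.integral_mono_on (by linarith [Real.pi_pos])
    (Continuous.intervalIntegrable (by fun_prop) _ _)
    (Continuous.intervalIntegrable (by fun_prop) _ _) fun x _ => ?_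
  linarith [Real.add_one_le_exp (b * Real.cos x)]

lemma vonMises_one_pos (b : ℝ) : 0 < vonMises b (fun _ => 1) :=
  lt_of_lt_of_le (by positivity) (two_pi_le_vonMises_one b)

/-- Integration by parts against the von Mises weight. -/
lemma vonMises_deriv (b : ℝ) {u u' : ℝ → ℝ} (hu : ∀ x, HasDerivAt u (u' x) x)
    (hu' : Continuous u') :
    vonMises b u' =
      b * vonMises b (fun x => Real.sin x * u x) + (u Real.pi - u (-Real.pi)) * Real.exp (-b) := by
  have hc : Continuous u := continuous_iff_continuousAt.2 fun x => (hu x).continuousAt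
  have key : ∫ x in (-Real.pi)..Real.pi, (u' x * Real.exp (b * Real.cos x) +
      -b * (Real.sin x * u x) * Real.exp (b * Real.cos x)) =
      u Real.pi * Real.exp (b * Real.cos Real.pi) -
        u (-Real.pi) * Real.exp (b * Real.cos (-Real.pi)) := by
    refine intervalIntegral.integral_eq_sub_of_hasDerivAt
      (f := fun x => u x * Real.exp (b * Real.cos x)) (fun x _ => ?_)
      (Continuous.intervalIntegrable (by fun_prop) _ _)
    convert! (hu x).mul (((Real.hasDerivAt_cos x).const_mul b).exp) using 1
    ring
  rw [intervalIntegral.integral_add (intervalIntegrable_vonMises b hu' _ _)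
    (intervalIntegrable_vonMises b (f := fun x => -b * (Real.sin x * u x)) (by fun_prop) _ _)]
    at key
  have h2 := vonMises_const_mul b (-b) (fun x => Real.sin x * u x)
  unfold vonMises at h2 ⊢
  simp only [Real.cos_neg, Real.cos_pi, mul_neg, mul_one] at key
  linarith

lemma vonMises_cauchySchwarz (b : ℝ) {u v : ℝ → ℝ} (hu : Continuous u) (hv : Continuous v) :
    vonMises b (fun x => u x * v x) ^ 2 ≤
      vonMises b (fun x => u x ^ 2) * vonMises b (fun x => v x ^ 2) := by
  have h : ∀ s : ℝ, 0 ≤ vonMises b (fun x => v x ^ 2) * (s * s) +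
      2 * vonMises b (fun x => u x * v x) * s + vonMises b (fun x => u x ^ 2) := by
    intro s
    have h0 : 0 ≤ vonMises b (fun x => (u x + s * v x) ^ 2) :=
      vonMises_nonneg b fun x => sq_nonneg _
    have e : (fun x => (u x + s * v x) ^ 2) =
        fun x => u x ^ 2 + ((2 * s) * (u x * v x) + s ^ 2 * v x ^ 2) := by
      ext x; ring
    rw [e, vonMises_add b (by fun_prop) (by fun_prop), vonMises_add b (by fun_prop) (by fun_prop),
      vonMises_const_mul, vonMises_const_mul] at h0
    linarith
  have := discrim_le_zero h
  unfold discrim at this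
  linarith

lemma abs_charFn_le_one (b t : ℝ) : |charFn b t| ≤ 1 := by
  have hm := vonMises_one_pos b
  rw [charFn, abs_div, abs_of_pos hm, div_le_one hm, abs_le]
  constructor
  · have := vonMises_mono b (f := fun _ => -1 * 1) (f' := fun x => Real.cos (t * x))
      (by fun_prop) (by fun_prop) fun x _ => by linarith [Real.neg_one_le_cos (t * x)]
    rw [vonMises_const_mul] at this
    linarith
  · exact vonMises_mono b (by fun_prop) (by fun_prop) fun x _ => Real.cos_le_one _

/-- Integration by parts and the Cauchy–Schwarz inequality, up to the boundary term. -/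
lemma vonMises_sin_mul_sin_sq_le {b : ℝ} (hb : 0 ≤ b) (t : ℝ) :
    (b * vonMises b (fun x => Real.sin x * Real.sin (t * x))) ^ 2 ≤
      b * (1 - charFn b t ^ 2) * vonMises b (fun _ => 1) ^ 2 := by
  set m := vonMises b (fun _ => 1) with hm
  have hm0 : 0 < m := vonMises_one_pos b
  have h1 : b * vonMises b (fun x => Real.sin x ^ 2) ≤ m := by
    have h := vonMises_deriv b Real.hasDerivAt_sin (by fun_prop)
    have h' : vonMises b Real.cos ≤ m :=
      vonMises_mono b (by fun_prop) (by fun_prop) fun x _ => Real.cos_le_one x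
    simp only [Real.sin_pi, Real.sin_neg, neg_zero, sub_zero, zero_mul, add_zero, ← sq] at h
    linarith
  have h2 := vonMises_cauchySchwarz b (u := fun x => Real.sin x) (v := fun x => Real.sin (t * x))
    (by fun_prop) (by fun_prop)
  have h3 := vonMises_cauchySchwarz b (u := fun x => Real.cos (t * x)) (v := fun _ => 1)
    (by fun_prop) (by fun_prop)
  have h4 : vonMises b (fun x => Real.sin (t * x) ^ 2) +
      vonMises b (fun x => Real.cos (t * x) ^ 2) = m := by
    rw [← vonMises_add b (by fun_prop) (by fun_prop)]
    simp only [Real.sin_sq_add_cos_sq, hm]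
  have h5 : vonMises b (fun x => Real.cos (t * x)) = charFn b t * m := by
    rw [charFn, div_mul_cancel₀ _ hm0.ne']
  simp only [mul_one, one_pow, ← hm] at h3
  rw [h5] at h3
  have h6 : vonMises b (fun x => Real.sin (t * x) ^ 2) ≤ (1 - charFn b t ^ 2) * m := by
    have : charFn b t ^ 2 * m ≤ vonMises b (fun x => Real.cos (t * x) ^ 2) := by
      refine le_of_mul_le_mul_right ?_ hm0
      linarith
    linarith
  have h7 : 0 ≤ vonMises b (fun x => Real.sin (t * x) ^ 2) :=
    vonMises_nonneg b fun x => sq_nonneg _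
  calc (b * vonMises b (fun x => Real.sin x * Real.sin (t * x))) ^ 2
      = b * (b * vonMises b (fun x => Real.sin x * Real.sin (t * x)) ^ 2) := by ring
    _ ≤ b * ((b * vonMises b (fun x => Real.sin x ^ 2)) *
          vonMises b (fun x => Real.sin (t * x) ^ 2)) := by
        refine mul_le_mul_of_nonneg_left ?_ hb
        rw [mul_assoc]
        exact mul_le_mul_of_nonneg_left h2 hb
    _ ≤ b * (m * ((1 - charFn b t ^ 2) * m)) := by
        refine mul_le_mul_of_nonneg_left ?_ hb
        exact mul_le_mul h1 h6 h7 hm0.le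
    _ = _ := by ring

/-- The decay of the characteristic function, uniform in `b`. Integration by parts gives
`t φ(t) = b E[sin θ sin (tθ)] + 2 h(π) sin (π t)`, and the square of the first term is at most
`b (1 - φ(t)²)`. The boundary term is absorbed by `|t φ(t)| / 2` if `|φ(t)| ≥ 1/2`, and is bounded
by a multiple of `1 - φ(t)²` otherwise. -/
lemma charFn_sq_le {b : ℝ} (hb : 3 ≤ b) (t : ℝ) : charFn b t ^ 2 ≤ 1 / (1 + t ^ 2 / (13 * b)) := by
  set m := vonMises b (fun _ => 1) with hm
  have hm1 : 2 * Real.pi ≤ m := two_pi_le_vonMises_one b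
  have hm0 : 0 < m := vonMises_one_pos b
  set p := charFn b t with hp
  have hp1 : p ^ 2 ≤ 1 := (sq_le_one_iff_abs_le_one _).2 (abs_charFn_le_one b t)
  have hpi := Real.pi_gt_three
  have he : Real.exp (-b) ≤ 1 / 4 := by
    rw [Real.exp_neg, inv_eq_one_div]
    exact one_div_le_one_div_of_le (by norm_num) (by linarith [Real.add_one_le_exp b])
  have he0 := Real.exp_pos (-b)
  have hA := vonMises_sin_mul_sin_sq_le (b := b) (by linarith) t
  set A := b * vonMises b (fun x => Real.sin x * Real.sin (t * x)) with hAdef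
  have ibp : t * p * m = A + 2 * Real.sin (t * Real.pi) * Real.exp (-b) := by
    have h := vonMises_deriv b (u := fun x => Real.sin (t * x))
      (u' := fun x => t * Real.cos (t * x))
      (fun x => by
        convert! ((hasDerivAt_id x).const_mul t).sin using 1
        simp; ring) (by fun_prop)
    rw [vonMises_const_mul] at h
    have h5 : vonMises b (fun x => Real.cos (t * x)) = p * m := by
      rw [hp, charFn, div_mul_cancel₀ _ hm0.ne']
    rw [h5] at h
    simp only [mul_neg, Real.sin_neg, sub_neg_eq_add, ← hAdef] at h
    linarith
  set B := 2 * Real.sin (t * Real.pi) * Real.exp (-b) with hB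
  have main : t ^ 2 * p ^ 2 ≤ 13 * b * (1 - p ^ 2) := by
    have hb0 : 0 ≤ b * (1 - p ^ 2) := mul_nonneg (by linarith) (by linarith)
    rcases le_total (p ^ 2) (1 / 4) with hq | hq
    · have hB1 : B ^ 2 ≤ 1 / 4 := by
        have h1 : Real.sin (t * Real.pi) ^ 2 ≤ 1 := Real.sin_sq_le_one _
        have h2 : Real.exp (-b) ^ 2 ≤ (1 / 4) ^ 2 := pow_le_pow_left₀ he0.le he 2
        have : Real.sin (t * Real.pi) ^ 2 * Real.exp (-b) ^ 2 ≤ 1 * (1 / 4) ^ 2 :=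
          mul_le_mul h1 h2 (sq_nonneg _) zero_le_one
        rw [hB]; nlinarith
      have h2 : (t * p * m) ^ 2 ≤ 2 * A ^ 2 + 2 * B ^ 2 := by
        rw [ibp]; nlinarith [sq_nonneg (A - B)]
      have h3 : 2 * B ^ 2 ≤ b * (1 - p ^ 2) * m ^ 2 := by
        have : 1 ≤ b * (1 - p ^ 2) := by nlinarith
        nlinarith
      refine le_of_mul_le_mul_right ?_ (by positivity : 0 < m ^ 2)
      nlinarith [mul_nonneg hb0 (sq_nonneg m)]
    · have hB1 : B ^ 2 ≤ (t * p * m) ^ 2 / 4 := by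
        have h1 : Real.sin (t * Real.pi) ^ 2 ≤ (t * Real.pi) ^ 2 := by
          rw [sq_le_sq]; exact Real.abs_sin_le_abs
        have h2 : Real.exp (-b) ^ 2 ≤ (1 / 4) ^ 2 := pow_le_pow_left₀ he0.le he 2
        have h3 : Real.sin (t * Real.pi) ^ 2 * Real.exp (-b) ^ 2 ≤
            (t * Real.pi) ^ 2 * (1 / 4) ^ 2 :=
          mul_le_mul h1 h2 (sq_nonneg _) (sq_nonneg _)
        have h4 : (2 * Real.pi) ^ 2 ≤ m ^ 2 := pow_le_pow_left₀ (by positivity) hm1 2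
        have h5 : (2 * Real.pi) ^ 2 * (1 / 4) ≤ m ^ 2 * p ^ 2 :=
          mul_le_mul h4 hq (by norm_num) (sq_nonneg _)
        have h6 := mul_le_mul_of_nonneg_left h5 (sq_nonneg t)
        rw [hB]; nlinarith
      have h2 : (t * p * m) ^ 2 ≤ 4 * A ^ 2 := by
        have h : A = t * p * m - B := by linarith
        rw [h]; nlinarith [sq_nonneg (t * p * m - 2 * B)]
      refine le_of_mul_le_mul_right ?_ (by positivity : 0 < m ^ 2)
      nlinarith [mul_nonneg hb0 (sq_nonneg m)]
  rw [le_div_iff₀ (by positivity)]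
  have : p ^ 2 * (1 + t ^ 2 / (13 * b)) = p ^ 2 + (t ^ 2 * p ^ 2) / (13 * b) := by ring
  rw [this]
  have : t ^ 2 * p ^ 2 / (13 * b) ≤ 1 - p ^ 2 := by
    rw [div_le_iff₀ (by positivity)]; linarith
  linarith

/-- The variance bound `b E θ² ≤ 3 π²`, from `b (1 - cos θ) ≤ 2 b sin² θ + 4 exp (-b cos θ)`. -/
lemma one_sub_le_charFn {b : ℝ} (hb : 0 < b) (t : ℝ) : 1 - 15 * t ^ 2 / b ≤ charFn b t := by
  set m := vonMises b (fun _ => 1) with hm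
  have hm1 : 2 * Real.pi ≤ m := two_pi_le_vonMises_one b
  have hm0 : 0 < m := vonMises_one_pos b
  have hpi := Real.pi_gt_three
  have hcos : vonMises b Real.cos ≤ m :=
    vonMises_mono b (by fun_prop) (by fun_prop) fun x _ => Real.cos_le_one x
  have hsin : b * vonMises b (fun x => Real.sin x ^ 2) = vonMises b Real.cos := by
    have h := vonMises_deriv b Real.hasDerivAt_sin (by fun_prop)
    simp only [Real.sin_pi, Real.sin_neg, neg_zero, sub_zero, zero_mul, add_zero, ← sq] at h
    linarith
  have hexp : vonMises b (fun x => Real.exp (-(b * Real.cos x))) = 2 * Real.pi := by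
    unfold vonMises
    simp only [← Real.exp_add, neg_add_cancel, Real.exp_zero]
    simp
    ring
  have h1 : b * vonMises b (fun x => 1 - Real.cos x) ≤ 6 * m := by
    rw [← vonMises_const_mul]
    have : vonMises b (fun x => b * (1 - Real.cos x)) ≤
        vonMises b (fun x => 2 * b * Real.sin x ^ 2 + 4 * Real.exp (-(b * Real.cos x))) := by
      refine vonMises_mono b (by fun_prop) (by fun_prop) fun x _ => ?_
      have h0 := Real.exp_pos (-(b * Real.cos x))
      have h1 := Real.add_one_le_exp (-(b * Real.cos x))
      rw [Real.sin_sq]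
      -- Near `π`, where `sin² θ` degenerates, the exponential term is at least `2 b`.
      rcases le_total (Real.cos x) (-(1 / 2)) with h | h
      · nlinarith [Real.neg_one_le_cos x, mul_nonneg hb.le (sub_nonneg.2 (Real.cos_sq_le_one x))]
      · have h3 : 0 ≤ (1 - Real.cos x) * (1 + 2 * Real.cos x) :=
          mul_nonneg (by linarith [Real.cos_le_one x]) (by linarith)
        nlinarith [mul_nonneg hb.le h3]
    rw [vonMises_add b (by fun_prop) (by fun_prop), vonMises_const_mul b (2 * b),
      vonMises_const_mul b 4, hexp] at this
    linarith
  have h2 : vonMises b (fun x => 1 - t ^ 2 * Real.pi ^ 2 / 4 * (1 - Real.cos x)) ≤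
      vonMises b (fun x => Real.cos (t * x)) := by
    refine vonMises_mono b (by fun_prop) (by fun_prop) fun x hx => ?_
    have h3 := Real.one_sub_sq_div_two_le_cos (x := t * x)
    have h4 := Real.cos_le_one_sub_mul_cos_sq (x := x) (abs_le.2 hx)
    have h5 : x ^ 2 ≤ Real.pi ^ 2 / 2 * (1 - Real.cos x) := by
      have h6 : 2 / Real.pi ^ 2 * x ^ 2 ≤ 1 - Real.cos x := by linarith
      calc x ^ 2 = Real.pi ^ 2 / 2 * (2 / Real.pi ^ 2 * x ^ 2) := by field_simp
        _ ≤ _ := mul_le_mul_of_nonneg_left h6 (by positivity)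
    nlinarith [mul_le_mul_of_nonneg_left h5 (sq_nonneg t)]
  have e : (fun x => 1 - t ^ 2 * Real.pi ^ 2 / 4 * (1 - Real.cos x)) =
      fun x => 1 + (-(t ^ 2 * Real.pi ^ 2 / 4)) * (1 - Real.cos x) := by ext x; ring
  rw [e, vonMises_add b (by fun_prop) (by fun_prop), vonMises_const_mul, ← hm] at h2
  rw [charFn, ← hm, le_div_iff₀ hm0]
  refine le_trans ?_ h2
  have hp2 : Real.pi ^ 2 ≤ 10 := by
    have := Real.pi_lt_d2
    nlinarith
  have h7 : vonMises b (fun x => 1 - Real.cos x) ≤ 6 * m / b := by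
    rw [le_div_iff₀ hb]; linarith
  have h8 : 0 ≤ vonMises b (fun x => 1 - Real.cos x) :=
    vonMises_nonneg b fun x => by linarith [Real.cos_le_one x]
  have h9 : t ^ 2 * Real.pi ^ 2 / 4 * vonMises b (fun x => 1 - Real.cos x) ≤
      t ^ 2 * 10 / 4 * (6 * m / b) := by gcongr
  have : 15 * t ^ 2 / b * m = t ^ 2 * 10 / 4 * (6 * m / b) := by ring
  linarith

/-! ### The increment density and its Fourier transform -/

lemma normConst_eq_vonMises (J σ : ℝ) :
    normConst J σ = vonMises (J / (2 * σ ^ 2)) (fun _ => 1) := by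
  unfold normConst vonMises
  rw [← AddCircle.intervalIntegral_preimage (2 * Real.pi) (-Real.pi)]
  simp only [cosT_coe, one_mul]
  congr 1
  ring

lemma normConst_pos (J σ : ℝ) : 0 < normConst J σ := by
  rw [normConst_eq_vonMises]; exact vonMises_one_pos _

lemma stepDensity_pos (J σ : ℝ) (x : Torus) : 0 < stepDensity J σ x := by
  have := normConst_pos J σ
  unfold stepDensity
  positivity

lemma g_nonneg (J σ y : ℝ) : 0 ≤ g J σ y :=
  indicator_nonneg (fun _ _ => mul_nonneg (by positivity) (stepDensity_pos J σ _).le) _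

lemma continuous_stepDensity_mul (J σ : ℝ) :
    Continuous fun y : ℝ => 2 * Real.pi * stepDensity J σ ((2 * Real.pi * y : ℝ) : Torus) := by
  have h := continuous_stepDensity J σ
  have h2 : Continuous fun y : ℝ => ((2 * Real.pi * y : ℝ) : Torus) :=
    (AddCircle.continuous_mk' _).comp (by fun_prop)
  exact (h.comp h2).const_mul _

lemma exists_g_le (J σ : ℝ) : ∃ K, ∀ y, g J σ y ≤ K := by
  obtain ⟨K, hK⟩ := (isCompact_Icc (a := -(1 / 2 : ℝ)) (b := 1 / 2)).bddAbove_image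
    (continuous_stepDensity_mul J σ).continuousOn
  refine ⟨max K 0, fun y => ?_⟩
  unfold g
  refine indicator_apply_le' (fun hy => ?_) fun _ => le_max_right _ _
  exact le_max_of_le_left (hK ⟨y, Ioc_subset_Icc_self hy, rfl⟩)

lemma measurable_g (J σ : ℝ) : Measurable (g J σ) :=
  (continuous_stepDensity_mul J σ).measurable.indicator measurableSet_Ioc

lemma integrable_g (J σ : ℝ) : Integrable (g J σ) := by
  refine IntegrableOn.integrable_indicator ?_ measurableSet_Ioc
  exact ((continuous_stepDensity_mul J σ).continuousOn.integrableOn_compact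
    isCompact_Icc).mono_set Ioc_subset_Icc_self

lemma hasCompactSupport_g (J σ : ℝ) : HasCompactSupport (g J σ) := by
  refine HasCompactSupport.intro (isCompact_Icc (a := -(1 / 2 : ℝ)) (b := 1 / 2)) fun x hx => ?_
  exact indicator_of_notMem (fun h => hx (Ioc_subset_Icc_self h)) _

lemma continuousAt_g (J σ : ℝ) {y : ℝ} (h1 : y ≠ -(1 / 2)) (h2 : y ≠ 1 / 2) :
    ContinuousAt (g J σ) y := by
  unfold g
  refine ContinuousOn.continuousAt_indicator
    (continuous_stepDensity_mul J σ).continuousOn ?_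
  rw [frontier_Ioc (by norm_num)]
  simp only [mem_insert_iff, mem_singleton_iff, not_or]
  exact ⟨h1, h2⟩

lemma fourier_g (J σ t : ℝ) :
    𝓕 (fun y => (g J σ y : ℂ)) t = (charFn (J / (2 * σ ^ 2)) t : ℂ) := by
  set b := J / (2 * σ ^ 2) with hb
  have hpi := Real.pi_pos
  have hm := normConst_pos J σ
  rw [Real.fourier_real_eq_integral_exp_smul]
  obtain ⟨F, hF⟩ : ∃ F : ℝ → ℂ, F = fun x : ℝ => (((1 / normConst J σ) *
      (Real.cos (t * x) * Real.exp (b * Real.cos x)) : ℝ) : ℂ) -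
      (((1 / normConst J σ) * (Real.sin (t * x) * Real.exp (b * Real.cos x)) : ℝ) : ℂ)
        * Complex.I := ⟨_, rfl⟩
  have e1 : (fun v : ℝ => Complex.exp (↑(-2 * Real.pi * v * t) * Complex.I) • (g J σ v : ℂ)) =
      (Ioc (-(1 / 2)) (1 / 2) : Set ℝ).indicator fun v : ℝ =>
        (2 * Real.pi : ℝ) • F (2 * Real.pi * v) := by
    ext v
    rw [hF]
    unfold g
    by_cases hv : v ∈ Ioc (-(1 / 2) : ℝ) (1 / 2)
    · rw [indicator_of_mem hv, indicator_of_mem hv, Complex.exp_mul_I, ← Complex.ofReal_cos,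
        ← Complex.ofReal_sin, show -2 * Real.pi * v * t = -(t * (2 * Real.pi * v)) by ring,
        Real.cos_neg, Real.sin_neg, stepDensity, cosT_coe, ← hb, Complex.real_smul, smul_eq_mul]
      push_cast
      ring
    · rw [indicator_of_notMem hv, indicator_of_notMem hv]
      simp
  rw [e1, integral_indicator measurableSet_Ioc,
    ← intervalIntegral.integral_of_le (by norm_num), intervalIntegral.integral_smul,
    intervalIntegral.smul_integral_comp_mul_left,
    show 2 * Real.pi * -(1 / 2) = -Real.pi by ring, show 2 * Real.pi * (1 / 2) = Real.pi by ring,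
    hF,
    intervalIntegral.integral_sub (Continuous.intervalIntegrable (by fun_prop) _ _)
      (Continuous.intervalIntegrable (by fun_prop) _ _), intervalIntegral.integral_mul_const,
    intervalIntegral.integral_ofReal, intervalIntegral.integral_ofReal,
    intervalIntegral.integral_const_mul, intervalIntegral.integral_const_mul]
  have hodd : ∫ x in (-Real.pi)..Real.pi, Real.sin (t * x) * Real.exp (b * Real.cos x) = 0 := by
    have h := intervalIntegral.integral_comp_neg (a := -Real.pi) (b := Real.pi)
      (fun x => Real.sin (t * x) * Real.exp (b * Real.cos x))
    simp only [mul_neg, Real.sin_neg, Real.cos_neg, neg_mul, neg_neg,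
      intervalIntegral.integral_neg] at h
    linarith
  rw [hodd, charFn, ← normConst_eq_vonMises, vonMises]
  push_cast
  ring

/-! ### Convolution powers of the increment density -/

lemma convPow_succ (f : ℝ → ℝ) {n : ℕ} (hn : 1 ≤ n) :
    convPow f (n + 1) = convolution (convPow f n) f (ContinuousLinearMap.mul ℝ ℝ) volume := by
  obtain ⟨n, rfl⟩ := Nat.exists_eq_add_of_le' hn
  rfl

lemma convPow_succ_apply (f : ℝ → ℝ) {n : ℕ} (hn : 1 ≤ n) (y : ℝ) :
    convPow f (n + 1) y = ∫ s, convPow f n s * f (y - s) := by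
  rw [convPow_succ f hn]; rfl

lemma convPow_nonneg {f : ℝ → ℝ} (hf : ∀ y, 0 ≤ f y) {n : ℕ} (hn : 1 ≤ n) (y : ℝ) :
    0 ≤ convPow f n y := by
  induction n, hn using Nat.le_induction generalizing y with
  | base => exact hf y
  | succ n hn ih =>
    rw [convPow_succ_apply f hn]
    exact integral_nonneg fun s => mul_nonneg (ih s) (hf _)

lemma integrable_convPow {f : ℝ → ℝ} (hf : Integrable f) {n : ℕ} (hn : 1 ≤ n) :
    Integrable (convPow f n) := by
  induction n, hn using Nat.le_induction with
  | base => exact hf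
  | succ n hn ih =>
    rw [convPow_succ f hn]
    exact ih.integrable_convolution _ hf

lemma hasCompactSupport_convPow {f : ℝ → ℝ} (hf : HasCompactSupport f) {n : ℕ} (hn : 1 ≤ n) :
    HasCompactSupport (convPow f n) := by
  induction n, hn using Nat.le_induction with
  | base => exact hf
  | succ n hn ih =>
    rw [convPow_succ f hn]
    exact ih.convolution _ hf

lemma integrable_convPow_mul_g (J σ : ℝ) {n : ℕ} (hn : 1 ≤ n) (y : ℝ) :
    Integrable fun s => convPow (g J σ) n s * g J σ (y - s) := by
  obtain ⟨K, hK⟩ := exists_g_le J σ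
  refine (integrable_convPow (integrable_g J σ) hn).mul_bdd (c := K)
    ((measurable_g J σ).comp (measurable_const.sub measurable_id)).aestronglyMeasurable ?_
  refine Eventually.of_forall fun s => ?_
  rw [Real.norm_of_nonneg (g_nonneg _ _ _)]
  exact hK _

/-- The density `g` has jumps at `±1/2`, but convolving with it makes an integrable function
continuous, because it is bounded and continuous almost everywhere. -/
lemma continuous_convPow (J σ : ℝ) {n : ℕ} (hn : 2 ≤ n) : Continuous (convPow (g J σ) n) := by
  obtain ⟨n, rfl⟩ := Nat.exists_eq_add_of_le' hn
  obtain ⟨K, hK⟩ := exists_g_le J σ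
  have hn1 : 1 ≤ n + 1 := by omega
  have hint := integrable_convPow (integrable_g J σ) hn1
  have e : convPow (g J σ) (n + 2) = fun y => ∫ s, convPow (g J σ) (n + 1) s * g J σ (y - s) :=
    funext fun y => convPow_succ_apply _ hn1 y
  rw [e]
  refine continuous_iff_continuousAt.2 fun y => ?_
  refine continuousAt_of_dominated (bound := fun s => ‖convPow (g J σ) (n + 1) s‖ * K)
    (Eventually.of_forall fun z => (integrable_convPow_mul_g J σ hn1 z).aestronglyMeasurable)
    (Eventually.of_forall fun z => Eventually.of_forall fun s => ?_) (hint.norm.mul_const K) ?_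
  · rw [norm_mul, Real.norm_of_nonneg (g_nonneg J σ _)]
    exact mul_le_mul_of_nonneg_left (hK _) (norm_nonneg _)
  · have h : ∀ᵐ s : ℝ, s ∉ ({y + 1 / 2, y - 1 / 2} : Set ℝ) :=
      compl_mem_ae_iff.2 (Set.Finite.measure_zero (by simp) _)
    filter_upwards [h] with s hs
    simp only [mem_insert_iff, mem_singleton_iff, not_or] at hs
    refine ContinuousAt.mul continuousAt_const ?_
    refine ContinuousAt.comp (f := fun z => z - s) (g := g J σ) ?_ (by fun_prop)
    exact continuousAt_g J σ (fun h => hs.1 (by linarith)) (fun h => hs.2 (by linarith))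

lemma fourier_convPow (J σ t : ℝ) {n : ℕ} (hn : 1 ≤ n) :
    𝓕 (fun y => (convPow (g J σ) n y : ℂ)) t = (charFn (J / (2 * σ ^ 2)) t : ℂ) ^ n := by
  induction n, hn using Nat.le_induction with
  | base => rw [pow_one]; exact fourier_g J σ t
  | succ n hn ih =>
    have e : (fun y => (convPow (g J σ) (n + 1) y : ℂ)) =
        convolution (fun y => (convPow (g J σ) n y : ℂ)) (fun y => (g J σ y : ℂ))
          (ContinuousLinearMap.mul ℂ ℂ) volume := by
      ext y
      rw [convPow_succ_apply _ hn, ← integral_complex_ofReal]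
      simp [convolution]
    have h := Real.fourier_mul_convolution_eq (f₁ := fun y => (convPow (g J σ) n y : ℂ))
      (f₂ := fun y => (g J σ y : ℂ))
      (integrable_convPow (integrable_g J σ) hn).ofReal (integrable_g J σ).ofReal t
    rw [e]
    refine h.trans ?_
    rw [pow_succ, ← ih, ← fourier_g]

lemma ofReal_convPow_succ (J σ : ℝ) {n : ℕ} (hn : 1 ≤ n) (y : ℝ) :
    ENNReal.ofReal (convPow (g J σ) (n + 1) y) =
      ∫⁻ s, ENNReal.ofReal (convPow (g J σ) n s) * ENNReal.ofReal (g J σ (y - s)) := by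
  have hnn := fun s => convPow_nonneg (g_nonneg J σ) hn s
  rw [convPow_succ_apply _ hn, ofReal_integral_eq_lintegral_ofReal
    (integrable_convPow_mul_g J σ hn y)
    (Eventually.of_forall fun s => mul_nonneg (hnn s) (g_nonneg _ _ _))]
  exact lintegral_congr fun s => ENNReal.ofReal_mul (hnn s)

lemma measurable_convPow (J σ : ℝ) {n : ℕ} (hn : 1 ≤ n) : Measurable (convPow (g J σ) n) := by
  obtain rfl | h : n = 1 ∨ 2 ≤ n := by omega
  · exact measurable_g J σ
  · exact (continuous_convPow J σ h).measurable

/-! ### The local limit bounds -/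

lemma integrable_one_div_one_add_mul_sq {s : ℝ} (hs : 0 < s) :
    Integrable fun t : ℝ => 1 / (1 + (s * t) ^ 2) := by
  simpa only [one_div] using integrable_inv_one_add_sq.comp_mul_left' hs.ne'

lemma integral_one_div_one_add_mul_sq {s : ℝ} (hs : 0 < s) :
    ∫ t : ℝ, 1 / (1 + (s * t) ^ 2) = Real.pi / s := by
  have h := Measure.integral_comp_mul_left (fun t : ℝ => (1 + t ^ 2)⁻¹) s
  rw [integral_univ_inv_one_add_sq, abs_of_pos (inv_pos.2 hs), smul_eq_mul] at h
  simp only [one_div]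
  rw [h]
  ring

lemma continuous_charFn (b : ℝ) : Continuous (charFn b) := by
  refine Continuous.div_const ?_ _
  unfold vonMises
  exact intervalIntegral.continuous_parametric_intervalIntegral_of_continuous' (by fun_prop) _ _

lemma charFn_zero (b : ℝ) : charFn b 0 = 1 := by
  simp [charFn, (vonMises_one_pos b).ne']

/-- `charFn_sq_le` and Bernoulli's inequality with exponent `M / 2`. -/
lemma abs_charFn_pow_le {b : ℝ} (hb : 3 ≤ b) {M : ℕ} (hM : 2 ≤ M) (t : ℝ) :
    |charFn b t ^ M| ≤ 1 / (1 + M / (26 * b) * t ^ 2) := by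
  have hM' : (2 : ℝ) ≤ M := by exact_mod_cast hM
  set x := t ^ 2 / (13 * b) with hx
  have hx0 : 0 ≤ x := by positivity
  have e : M / (26 * b) * t ^ 2 = M / 2 * x := by rw [hx]; field_simp; ring
  rw [e]
  have hr : 0 ≤ 1 / (1 + M / 2 * x) := by positivity
  refine abs_le_of_sq_le_sq ?_ hr
  have h1 := one_add_mul_self_le_rpow_one_add (s := x) (p := M / 2) (by linarith) (by linarith)
  have h2 : ((1 + x) ^ ((M : ℝ) / 2)) ^ 2 = (1 + x) ^ M := by
    rw [← Real.rpow_natCast, ← Real.rpow_mul (by positivity), ← Real.rpow_natCast]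
    congr 1
    push_cast
    ring
  have h3 : (1 + M / 2 * x) ^ 2 ≤ (1 + x) ^ M := by
    rw [← h2]; exact pow_le_pow_left₀ (by positivity) h1 2
  calc (charFn b t ^ M) ^ 2 = (charFn b t ^ 2) ^ M := by ring
    _ ≤ (1 / (1 + x)) ^ M := pow_le_pow_left₀ (sq_nonneg _) (charFn_sq_le hb t) M
    _ = 1 / (1 + x) ^ M := by rw [div_pow, one_pow]
    _ ≤ 1 / (1 + M / 2 * x) ^ 2 := one_div_le_one_div_of_le (by positivity) h3
    _ = _ := by rw [div_pow, one_pow]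

/-- `abs_charFn_pow_le` in the scale `√(b / M)` of the convolution power. -/
lemma abs_charFn_pow_le' {b : ℝ} (hb : 3 ≤ b) {M : ℕ} (hM : 2 ≤ M) (t : ℝ) :
    |charFn b t ^ M| ≤ 1 / (1 + ((√(26 * (b / M)))⁻¹ * t) ^ 2) := by
  refine (abs_charFn_pow_le hb hM t).trans_eq ?_
  rw [mul_pow, inv_pow, Real.sq_sqrt (by positivity), ← mul_div_assoc, inv_div]

lemma integrable_charFn_pow {b : ℝ} (hb : 3 ≤ b) {M : ℕ} (hM : 2 ≤ M) :
    Integrable fun t => charFn b t ^ M := by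
  have : (0 : ℝ) < M := by positivity
  refine (integrable_one_div_one_add_mul_sq (s := (√(26 * (b / M)))⁻¹) (by positivity)).mono'
    ((continuous_charFn b).pow M).aestronglyMeasurable (Eventually.of_forall fun t => ?_)
  exact abs_charFn_pow_le' hb hM t

/-- Fourier inversion for the convolution powers. -/
lemma convPow_eq_integral {J σ : ℝ} (hb : 3 ≤ J / (2 * σ ^ 2)) {M : ℕ} (hM : 2 ≤ M) (y : ℝ) :
    convPow (g J σ) M y =
      ∫ t, Real.cos (2 * Real.pi * t * y) * charFn (J / (2 * σ ^ 2)) t ^ M := by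
  set b := J / (2 * σ ^ 2) with hbdef
  have hM1 : 1 ≤ M := by omega
  have hF : 𝓕 (fun z => (convPow (g J σ) M z : ℂ)) = fun t => ((charFn b t ^ M : ℝ) : ℂ) := by
    ext t
    rw [fourier_convPow J σ t hM1]
    push_cast
    rfl
  have hint := integrable_charFn_pow hb hM
  have h := (Complex.continuous_ofReal.comp (continuous_convPow J σ hM)).fourierInv_fourier_eq
    (integrable_convPow (integrable_g J σ) hM1).ofReal
    (by change Integrable (𝓕 (fun z => (convPow (g J σ) M z : ℂ))); rw [hF]; exact hint.ofReal)
  have h' := congrFun h y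
  change 𝓕⁻ (𝓕 (fun z => (convPow (g J σ) M z : ℂ))) y = (convPow (g J σ) M y : ℂ) at h'
  rw [hF, Real.fourierInv_eq'] at h'
  have h2 := congrArg Complex.re h'
  rw [Complex.ofReal_re] at h2
  rw [← h2]
  have hint2 : Integrable fun v : ℝ => Complex.exp (↑(2 * Real.pi * inner ℝ v y) * Complex.I) •
      ((charFn b v ^ M : ℝ) : ℂ) := by
    refine hint.ofReal.bdd_mul (c := 1) (Continuous.aestronglyMeasurable (by fun_prop)) ?_
    exact Eventually.of_forall fun v => (Complex.norm_exp_ofReal_mul_I _).le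
  have h3 := integral_re hint2
  change _ = Complex.re _ at h3
  rw [← h3]
  refine integral_congr_ae (Eventually.of_forall fun v => ?_)
  simp only [smul_eq_mul, RCLike.re_to_complex]
  rw [Complex.re_mul_ofReal, Complex.exp_ofReal_mul_I_re]
  simp only [RCLike.inner_apply, conj_trivial]
  congr 2
  ring

lemma convPow_le {J σ : ℝ} (hb : 3 ≤ J / (2 * σ ^ 2)) {M : ℕ} (hM : 2 ≤ M) (y : ℝ) :
    convPow (g J σ) M y ≤ 20 * √(J / (2 * σ ^ 2) / M) := by
  rw [convPow_eq_integral hb hM]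
  set b := J / (2 * σ ^ 2) with hbdef
  have hM0 : (0 : ℝ) < M := by positivity
  have hb0 : 0 < b := by linarith
  have hs : 0 < (√(26 * (b / M)))⁻¹ := by positivity
  refine (Real.le_norm_self _).trans ((norm_integral_le_of_norm_le
    (integrable_one_div_one_add_mul_sq hs) (Eventually.of_forall fun t => ?_)).trans ?_)
  · rw [Real.norm_eq_abs, abs_mul]
    exact (mul_le_of_le_one_left (abs_nonneg _) (Real.abs_cos_le_one _)).trans
      (abs_charFn_pow_le' hb hM t)
  · rw [integral_one_div_one_add_mul_sq hs, div_inv_eq_mul, Real.sqrt_mul (by norm_num),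
      ← mul_assoc]
    refine mul_le_mul_of_nonneg_right ?_ (Real.sqrt_nonneg _)
    have h1 : √(26 : ℝ) ≤ 5.1 := Real.sqrt_le_iff.2 ⟨by norm_num, by norm_num⟩
    nlinarith [Real.pi_lt_d2, Real.pi_pos, Real.sqrt_nonneg 26]

/-- The inversion integral restricted to `|t| ≤ 4000 √(b / M)` is nonnegative, and at least
`√(b / M) / 12` because of its part `|t| ≤ √(b / M) / 6`; the rest is at most `√(b / M) / 24`. -/
lemma le_convPow {J σ : ℝ} (hb : 3 ≤ J / (2 * σ ^ 2)) {M : ℕ} (hM : 15 * 4000 ^ 2 ≤ M) {y : ℝ}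
    (hy : 2 * Real.pi * 4000 * √(J / (2 * σ ^ 2) / M) * |y| ≤ 1) :
    1 / 24 * √(J / (2 * σ ^ 2) / M) ≤ convPow (g J σ) M y := by
  have hM2 : 2 ≤ M := by omega
  rw [convPow_eq_integral hb hM2]
  set b := J / (2 * σ ^ 2) with hbdef
  set u := √(b / M) with hu
  have hM0 : (0 : ℝ) < M := by positivity
  have hMr : (15 * 4000 ^ 2 : ℝ) ≤ M := by exact_mod_cast hM
  have hb0 : 0 < b := by linarith
  have hu0 : 0 < u := by positivity
  have hu2 : u ^ 2 = b / M := Real.sq_sqrt (by positivity)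
  have hMu : M * u ^ 2 = b := by rw [hu2]; field_simp
  have hs : 0 < (4000 * u)⁻¹ := by positivity
  have hI1 : Integrable ((Icc (-(u / 6)) (u / 6)).indicator fun _ : ℝ => (1 / 4 : ℝ)) :=
    IntegrableOn.integrable_indicator (by simp) measurableSet_Icc
  have hI2 := (integrable_one_div_one_add_mul_sq hs).const_mul (52 / 4000 ^ 2)
  have hint := integrable_charFn_pow hb hM2
  have hI3 : Integrable fun t => Real.cos (2 * Real.pi * t * y) * charFn b t ^ M := by
    refine hint.bdd_mul (c := 1) (Continuous.aestronglyMeasurable (by fun_prop)) ?_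
    exact Eventually.of_forall fun v => Real.abs_cos_le_one _
  have hle : ∀ t, (Icc (-(u / 6)) (u / 6)).indicator (fun _ : ℝ => (1 / 4 : ℝ)) t -
      52 / 4000 ^ 2 * (1 / (1 + ((4000 * u)⁻¹ * t) ^ 2)) ≤
      Real.cos (2 * Real.pi * t * y) * charFn b t ^ M := by
    intro t
    have hpos : 0 ≤ 52 / 4000 ^ 2 * (1 / (1 + ((4000 * u)⁻¹ * t) ^ 2)) := by positivity
    rcases le_or_gt |t| (4000 * u) with ht | ht
    · -- Here the hypothesis on `y` keeps the cosine above `1/2`.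
      have hcos : 1 / 2 ≤ Real.cos (2 * Real.pi * t * y) := by
        have h1 : |2 * Real.pi * t * y| ≤ 1 := by
          rw [abs_mul, abs_mul, abs_of_pos Real.two_pi_pos]
          refine le_trans ?_ hy
          have := mul_le_mul_of_nonneg_left ht Real.two_pi_pos.le
          have := mul_le_mul_of_nonneg_right this (abs_nonneg y)
          linarith
        have h2 := Real.one_sub_sq_div_two_le_cos (x := 2 * Real.pi * t * y)
        have h3 := (sq_le_one_iff_abs_le_one _).2 h1
        linarith
      have hch := one_sub_le_charFn hb0 t
      have ht2 : t ^ 2 ≤ (4000 * u) ^ 2 := by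
        rw [← sq_abs]; exact pow_le_pow_left₀ (abs_nonneg t) ht 2
      have hx1 : 15 * t ^ 2 / b ≤ 1 := by
        rw [div_le_one hb0]
        nlinarith [sq_nonneg u]
      have hp0 : 0 ≤ charFn b t ^ M := pow_nonneg (by linarith) _
      by_cases hti : t ∈ Icc (-(u / 6)) (u / 6)
      · rw [indicator_of_mem hti]
        have ht3 : t ^ 2 ≤ (u / 6) ^ 2 := by
          rw [← sq_abs]; exact pow_le_pow_left₀ (abs_nonneg t) (abs_le.2 hti) 2
        have h1 : 1 / 2 ≤ charFn b t ^ M := by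
          refine le_trans ?_ (pow_le_pow_left₀ (by linarith) hch M)
          have h2 := one_add_mul_le_pow (a := -(15 * t ^ 2 / b)) (by linarith) M
          rw [← sub_eq_add_neg] at h2
          refine le_trans ?_ h2
          have h4 : M * (15 * t ^ 2 / b) ≤ 1 / 2 := by
            rw [← mul_div_assoc, div_le_iff₀ hb0]
            nlinarith
          linarith
        nlinarith
      · rw [indicator_of_notMem hti]
        have : 0 ≤ Real.cos (2 * Real.pi * t * y) * charFn b t ^ M :=
          mul_nonneg (by linarith) hp0
        linarith
    · -- Here the Lorentzian bound `1 / (1 + t² / (26 u²))` is at most `52 / 4000²` times a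
      -- Lorentzian of width `4000 u`, whose integral is known.
      have hti : t ∉ Icc (-(u / 6)) (u / 6) := fun h => by
        have := abs_le.2 h
        linarith
      rw [indicator_of_notMem hti, zero_sub]
      have h1 : |Real.cos (2 * Real.pi * t * y) * charFn b t ^ M| ≤
          1 / (1 + M / (26 * b) * t ^ 2) := by
        rw [abs_mul]
        exact (mul_le_of_le_one_left (abs_nonneg _) (Real.abs_cos_le_one _)).trans
          (abs_charFn_pow_le hb hM2 t)
      refine le_trans (neg_le_neg ?_) (neg_le_of_abs_le h1)
      have ht2 : (4000 * u) ^ 2 ≤ t ^ 2 := by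
        rw [← sq_abs t]; exact pow_le_pow_left₀ (by positivity) ht.le 2
      have e1 : M / (26 * b) * t ^ 2 = t ^ 2 / (26 * u ^ 2) := by
        rw [hu2]; field_simp
      have e2 : 52 / 4000 ^ 2 * (1 / (1 + ((4000 * u)⁻¹ * t) ^ 2)) =
          1 / (((4000 * u) ^ 2 + t ^ 2) / (52 * u ^ 2)) := by
        field_simp
      rw [e1, e2]
      refine one_div_le_one_div_of_le (by positivity) ?_
      rw [div_le_iff₀ (by positivity)]
      have e3 : (1 + t ^ 2 / (26 * u ^ 2)) * (52 * u ^ 2) = 52 * u ^ 2 + 2 * t ^ 2 := by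
        field_simp
        ring
      rw [e3]
      nlinarith [sq_nonneg u]
  have h := integral_mono (hI1.sub hI2) hI3 hle
  simp only [Pi.sub_apply] at h
  rw [integral_sub hI1 hI2, integral_const_mul, integral_one_div_one_add_mul_sq hs,
    integral_indicator measurableSet_Icc, setIntegral_const] at h
  rw [Measure.real, Real.volume_Icc, ENNReal.toReal_ofReal (by linarith), smul_eq_mul,
    div_inv_eq_mul] at h
  refine le_trans ?_ h
  nlinarith [Real.pi_lt_d2]

/-! ### Poisson summation -/

lemma isBigO_cocompact_convPow (J σ : ℝ) {N : ℕ} (hN : 1 ≤ N) :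
    (fun y => (convPow (g J σ) N y : ℂ)) =O[cocompact ℝ] fun y : ℝ => |y| ^ (-2 : ℝ) := by
  have h := hasCompactSupport_convPow (hasCompactSupport_g J σ) hN
  rw [hasCompactSupport_iff_eventuallyEq] at h
  refine (EventuallyEq.isBigO (f₂ := fun _ => (0 : ℂ)) ?_).trans (isBigO_zero _ _)
  have h' : convPow (g J σ) N =ᶠ[cocompact ℝ] 0 := h.filter_mono cocompact_le_coclosedCompact
  filter_upwards [h'] with y hy
  simp [hy]

/-- At `n = 0` both sides are `0`, the right one because `1 / 0 = 0`. -/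
lemma abs_charFn_pow_int_le {b : ℝ} (hb : 3 ≤ b) {N : ℕ} (hN : 2 ≤ N) (n : ℤ) :
    |charFn b n ^ N - if n = 0 then 1 else 0| ≤ 26 * (b / N) * (1 / (n : ℝ) ^ 2) := by
  have hN0 : (0 : ℝ) < N := by positivity
  by_cases hn : n = 0
  · simp [hn, charFn_zero]
  · rw [if_neg hn, sub_zero]
    refine (abs_charFn_pow_le hb hN n).trans ?_
    have hn' : (0 : ℝ) < (n : ℝ) ^ 2 := by positivity
    calc 1 / (1 + N / (26 * b) * (n : ℝ) ^ 2) ≤ 1 / (N / (26 * b) * (n : ℝ) ^ 2) :=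
          one_div_le_one_div_of_le (by positivity) (by linarith)
      _ = _ := by field_simp

lemma summable_charFn_pow_int {b : ℝ} (hb : 3 ≤ b) {N : ℕ} (hN : 2 ≤ N) :
    Summable fun n : ℤ => charFn b n ^ N := by
  have h1 : Summable fun n : ℤ => charFn b n ^ N - if n = 0 then 1 else 0 :=
    ((Real.summable_one_div_int_pow.2 one_lt_two).mul_left (26 * (b / N))).of_norm_bounded
      fun n => abs_charFn_pow_int_le hb hN n
  have h2 : Summable fun n : ℤ => if n = 0 then (1 : ℝ) else 0 :=
    (hasSum_ite_eq 0 1).summable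
  simpa using h1.add h2

/-- Poisson summation for the convolution powers. -/
lemma tsum_convPow_eq {J σ : ℝ} (hb : 3 ≤ J / (2 * σ ^ 2)) {N : ℕ} (hN : 2 ≤ N) :
    ∑' j : ℤ, convPow (g J σ) N j = ∑' n : ℤ, charFn (J / (2 * σ ^ 2)) n ^ N := by
  have hN1 : 1 ≤ N := by omega
  have hF : ∀ n : ℤ, 𝓕 (fun z => (convPow (g J σ) N z : ℂ)) n =
      ((charFn (J / (2 * σ ^ 2)) n ^ N : ℝ) : ℂ) := by
    intro n
    rw [fourier_convPow J σ _ hN1]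
    push_cast
    rfl
  have h := Real.tsum_eq_tsum_fourier_of_rpow_decay_of_summable
    (f := fun z => (convPow (g J σ) N z : ℂ))
    (Complex.continuous_ofReal.comp (continuous_convPow J σ hN)) one_lt_two
    (isBigO_cocompact_convPow J σ hN1)
    (by simp only [hF]; exact Complex.ofRealCLM.summable (summable_charFn_pow_int hb hN)) 0
  simp only [hF, zero_add] at h
  have e : ∀ n : ℤ, fourier n ((0 : ℝ) : UnitAddCircle) = (1 : ℂ) := by
    intro n; simp
  simp only [e, mul_one] at h
  exact_mod_cast h

/-- The density of the sum of the increments on the circle is close to uniform. -/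
lemma exists_abs_tsum_convPow_sub_one_le : ∃ S : ℝ, 0 < S ∧ ∀ J σ : ℝ, 3 ≤ J / (2 * σ ^ 2) →
    ∀ N : ℕ, 2 ≤ N → |∑' j : ℤ, convPow (g J σ) N j - 1| ≤ S * (J / (2 * σ ^ 2) / N) := by
  have hs : Summable fun n : ℤ => 1 / (n : ℝ) ^ 2 := Real.summable_one_div_int_pow.2 one_lt_two
  have hS0 : 0 ≤ ∑' n : ℤ, 1 / (n : ℝ) ^ 2 := tsum_nonneg fun n => by positivity
  refine ⟨26 * (∑' n : ℤ, 1 / (n : ℝ) ^ 2) + 1, by positivity, fun J σ hb N hN => ?_⟩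
  rw [tsum_convPow_eq hb hN]
  set b := J / (2 * σ ^ 2)
  have h1 : HasSum (fun n : ℤ => if n = 0 then (1 : ℝ) else 0) 1 := hasSum_ite_eq 0 1
  have h2 := (summable_charFn_pow_int hb hN).hasSum.sub h1
  rw [← h2.tsum_eq]
  have h3 := tsum_of_norm_bounded
    (f := fun n : ℤ => charFn b n ^ N - if n = 0 then (1 : ℝ) else 0)
    (hs.hasSum.mul_left (26 * (b / N))) fun n => abs_charFn_pow_int_le hb hN n
  rw [Real.norm_eq_abs] at h3
  refine h3.trans ?_
  have : 0 ≤ b / N := by positivity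
  linarith

/-! ### The winding number and the convolution powers -/

lemma coe_rep (θ : Torus) : ((rep θ : ℝ) : Torus) = θ := AddCircle.coe_equivIoc

lemma rep_mem (θ : Torus) : rep θ ∈ Ioc (-Real.pi) Real.pi := by
  have h := (AddCircle.equivIoc (2 * Real.pi) (-Real.pi) θ).2
  exact ⟨h.1, h.2.trans_eq (by ring)⟩

lemma measurable_coe_two_pi_mul : Measurable fun r : ℝ => ((2 * Real.pi * r : ℝ) : Torus) :=
  ((AddCircle.continuous_mk' _).comp (continuous_const.mul continuous_id)).measurable

/-- The increment as a point of the torus and as a representative are both functions of one real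
variable with density `g`. -/
lemma lintegral_mul_stepDensity (J σ : ℝ) {Ψ : Torus → ℝ → ENNReal}
    (hΨ : Measurable (Function.uncurry Ψ)) :
    ∫⁻ ξ : Torus, Ψ ξ (rep ξ / (2 * Real.pi)) * ENNReal.ofReal (stepDensity J σ ξ) =
      ∫⁻ r : ℝ, Ψ ((2 * Real.pi * r : ℝ) : Torus) r * ENNReal.ofReal (g J σ r) := by
  have hpi := Real.pi_pos
  have hΨ' : Measurable fun r : ℝ => Ψ ((2 * Real.pi * r : ℝ) : Torus) r :=
    hΨ.comp (measurable_coe_two_pi_mul.prodMk measurable_id)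
  have hr : Measurable fun θ : Torus => rep θ / (2 * Real.pi) := measurable_rep.div_const _
  have hs : Measurable fun θ : Torus => ENNReal.ofReal (stepDensity J σ θ) :=
    (continuous_stepDensity J σ).measurable.ennreal_ofReal
  have h := congrArg (fun μ => ∫⁻ r, Ψ ((2 * Real.pi * r : ℝ) : Torus) r ∂μ)
    (map_rep_eq_withDensity J σ)
  rw [lintegral_map hΨ' hr, lintegral_withDensity_eq_lintegral_mul (g := fun θ : Torus =>
      Ψ ((2 * Real.pi * (rep θ / (2 * Real.pi)) : ℝ) : Torus) (rep θ / (2 * Real.pi)))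
      _ hs (hΨ'.comp hr),
    lintegral_withDensity_eq_lintegral_mul _ (measurable_g J σ).ennreal_ofReal hΨ'] at h
  simp only [Pi.mul_apply] at h
  simp only [mul_comm (ENNReal.ofReal _)] at h
  rw [← h]
  refine lintegral_congr fun θ => ?_
  have e : 2 * Real.pi * (rep θ / (2 * Real.pi)) = rep θ := by field_simp
  simp only [e, coe_rep]

/-- Integrating out the last point of an open chain. -/
lemma lintegral_chain_succ (J σ : ℝ) (n : ℕ) {F : Torus → Torus → ℝ → ENNReal}
    (hF : Measurable fun p : Torus × Torus × ℝ => F p.1 p.2.1 p.2.2) :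
    ∫⁻ x : Fin (n + 2) → Torus, F (x 0) (x (Fin.last (n + 1)))
        (∑ i : Fin (n + 1), rep (x i.succ - x i.castSucc) / (2 * Real.pi)) *
        ∏ i : Fin (n + 1), ENNReal.ofReal (stepDensity J σ (x i.succ - x i.castSucc)) =
      ∫⁻ x : Fin (n + 1) → Torus, (∫⁻ r : ℝ, F (x 0)
          (x (Fin.last n) + ((2 * Real.pi * r : ℝ) : Torus))
          (∑ i : Fin n, rep (x i.succ - x i.castSucc) / (2 * Real.pi) + r) *
            ENNReal.ofReal (g J σ r)) *
        ∏ i : Fin n, ENNReal.ofReal (stepDensity J σ (x i.succ - x i.castSucc)) := by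
  have hrep := measurable_rep
  have hstep := (continuous_stepDensity J σ).measurable
  have hmp := (volume_preserving_piFinSuccAbove (fun _ : Fin (n + 2) => Torus)
    (Fin.last (n + 1))).symm
  rw [← hmp.lintegral_comp_emb (MeasurableEquiv.measurableEmbedding _)]
  simp only [MeasurableEquiv.piFinSuccAbove_symm_apply, Fin.insertNthEquiv_apply,
    Fin.insertNth_last']
  have hmeas : Measurable fun x : Fin (n + 2) → Torus => F (x 0) (x (Fin.last (n + 1)))
        (∑ i : Fin (n + 1), rep (x i.succ - x i.castSucc) / (2 * Real.pi)) *
        ∏ i : Fin (n + 1), ENNReal.ofReal (stepDensity J σ (x i.succ - x i.castSucc)) := by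
    refine Measurable.mul (hF.comp (f := fun x : Fin (n + 2) → Torus => (x 0, x (Fin.last (n + 1)),
      ∑ i : Fin (n + 1), rep (x i.succ - x i.castSucc) / (2 * Real.pi))) ?_) ?_
    · fun_prop
    · fun_prop
  rw [Measure.volume_eq_prod, lintegral_prod_symm']
  swap
  · have := hmeas.comp hmp.measurable
    simpa only [MeasurableEquiv.piFinSuccAbove_symm_apply, Fin.insertNthEquiv_apply,
      Fin.insertNth_last', Function.comp_def] using this
  refine lintegral_congr fun x => ?_
  simp only [Fin.sum_univ_castSucc (n := n), Fin.prod_univ_castSucc (n := n), Fin.succ_last,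
    Fin.succ_castSucc, Fin.snoc_castSucc, Fin.snoc_last]
  have h0 : ∀ z : Torus, (Fin.snoc x z : Fin (n + 2) → Torus) 0 = x 0 := fun z => by
    rw [← Fin.castSucc_zero, Fin.snoc_castSucc]
  simp only [h0]
  -- Replace the last point by the last increment.
  rw [← lintegral_add_left_eq_self _ (x (Fin.last n))]
  simp only [add_sub_cancel_left]
  have hΨ : Measurable (Function.uncurry fun (ξ : Torus) (r : ℝ) => F (x 0) (x (Fin.last n) + ξ)
      (∑ i : Fin n, rep (x i.succ - x i.castSucc) / (2 * Real.pi) + r)) := by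
    refine hF.comp (f := fun p : Torus × ℝ => (x 0, x (Fin.last n) + p.1,
      ∑ i : Fin n, rep (x i.succ - x i.castSucc) / (2 * Real.pi) + p.2)) ?_
    fun_prop
  rw [← lintegral_mul_stepDensity J σ hΨ, ← lintegral_mul_const'']
  · refine lintegral_congr fun ξ => ?_
    ring
  · refine Measurable.aemeasurable (Measurable.mul ?_ (by fun_prop))
    exact hΨ.comp (measurable_id.prodMk (by fun_prop))

/-- In an open chain the total displacement has density `g^{⋆ n}`, whatever the starting point. -/
lemma lintegral_chain (J σ : ℝ) {n : ℕ} (hn : 1 ≤ n) {F : Torus → Torus → ℝ → ENNReal}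
    (hF : Measurable fun p : Torus × Torus × ℝ => F p.1 p.2.1 p.2.2) :
    ∫⁻ x : Fin (n + 1) → Torus, F (x 0) (x (Fin.last n))
        (∑ i : Fin n, rep (x i.succ - x i.castSucc) / (2 * Real.pi)) *
        ∏ i : Fin n, ENNReal.ofReal (stepDensity J σ (x i.succ - x i.castSucc)) =
      ∫⁻ a : Torus, ∫⁻ s : ℝ, F a (a + ((2 * Real.pi * s : ℝ) : Torus)) s *
        ENNReal.ofReal (convPow (g J σ) n s) := by
  have hcoe := measurable_coe_two_pi_mul
  have hg := measurable_g J σ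
  induction n, hn using Nat.le_induction generalizing F with
  | base =>
    rw [lintegral_chain_succ J σ 0 hF]
    have h := (volume_preserving_funUnique (Fin 1) Torus).lintegral_comp_emb
      (MeasurableEquiv.measurableEmbedding _) (fun a => ∫⁻ s : ℝ,
        F a (a + ((2 * Real.pi * s : ℝ) : Torus)) s * ENNReal.ofReal (convPow (g J σ) 1 s))
    rw [← h]
    refine lintegral_congr fun x => ?_
    simp [MeasurableEquiv.funUnique_apply, convPow]
  | succ n hn ih =>
    have hp := measurable_convPow J σ hn
    rw [lintegral_chain_succ J σ n hF, ih (F := fun a z s => ∫⁻ r : ℝ,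
      F a (z + ((2 * Real.pi * r : ℝ) : Torus)) (s + r) * ENNReal.ofReal (g J σ r))]
    · refine lintegral_congr fun a => ?_
      have hFa : Measurable fun y : ℝ => F a (a + ((2 * Real.pi * y : ℝ) : Torus)) y :=
        hF.comp (f := fun y : ℝ => (a, a + ((2 * Real.pi * y : ℝ) : Torus), y)) (by fun_prop)
      calc _ = ∫⁻ s : ℝ, ∫⁻ y : ℝ, F a (a + ((2 * Real.pi * y : ℝ) : Torus)) y *
            (ENNReal.ofReal (convPow (g J σ) n s) * ENNReal.ofReal (g J σ (y - s))) := by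
            refine lintegral_congr fun s => ?_
            conv_rhs => rw [← lintegral_add_left_eq_self _ s]
            rw [← lintegral_mul_const' _ _ ENNReal.ofReal_ne_top]
            refine lintegral_congr fun r => ?_
            rw [add_sub_cancel_left, add_assoc, ← AddCircle.coe_add, ← mul_add]
            ring
        _ = ∫⁻ y : ℝ, ∫⁻ s : ℝ, F a (a + ((2 * Real.pi * y : ℝ) : Torus)) y *
            (ENNReal.ofReal (convPow (g J σ) n s) * ENNReal.ofReal (g J σ (y - s))) :=
            lintegral_lintegral_swap (Measurable.aemeasurable
              ((hFa.comp measurable_snd).mul (by fun_prop)))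
        _ = _ := by
            refine lintegral_congr fun y => ?_
            rw [ofReal_convPow_succ J σ hn, lintegral_const_mul _ (by fun_prop)]
    · refine Measurable.lintegral_prod_right
        (f := fun (p : Torus × Torus × ℝ) (r : ℝ) =>
          F p.1 (p.2.1 + ((2 * Real.pi * r : ℝ) : Torus)) (p.2.2 + r) *
            ENNReal.ofReal (g J σ r)) ?_
      refine Measurable.mul (hF.comp (f := fun q : (Torus × Torus × ℝ) × ℝ =>
        (q.1.1, q.1.2.1 + ((2 * Real.pi * q.2 : ℝ) : Torus), q.1.2.2 + q.2)) ?_) ?_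
      · fun_prop
      · exact (hg.comp measurable_snd).ennreal_ofReal

lemma finRotate_symm_zero (n : ℕ) : (finRotate (n + 1)).symm 0 = Fin.last n := by
  rw [Equiv.symm_apply_eq, finRotate_last]

lemma finRotate_symm_succ (n : ℕ) (i : Fin n) :
    (finRotate (n + 1)).symm i.succ = i.castSucc := by
  rw [Equiv.symm_apply_eq, finRotate_apply, Fin.coeSucc_eq_succ]

lemma measurable_incr {N : ℕ} (i : Fin N) : Measurable fun x : Fin N → Torus => incr x i := by
  unfold incr
  fun_prop

/-- The last increment `-2πs` closes the chain with winding number `k` if and only if its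
representative is `2π(k - s)`. -/
lemma indicator_closing_eq (J σ : ℝ) (k : ℤ) (s : ℝ) :
    ({(k : ℝ)} : Set ℝ).indicator (1 : ℝ → ENNReal)
        (rep (-((2 * Real.pi * s : ℝ) : Torus)) / (2 * Real.pi) + s) *
      ENNReal.ofReal (stepDensity J σ (-((2 * Real.pi * s : ℝ) : Torus))) =
    ENNReal.ofReal (g J σ (k - s)) / ENNReal.ofReal (2 * Real.pi) := by
  have hpi := Real.pi_pos
  have hc : ((2 * Real.pi * (k - s) : ℝ) : Torus) = -((2 * Real.pi * s : ℝ) : Torus) := by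
    have h : (((k : ℝ) * (2 * Real.pi) : ℝ) : Torus) = 0 := by
      rw [← zsmul_eq_mul, AddCircle.coe_zsmul, AddCircle.coe_period, zsmul_zero]
    rw [show 2 * Real.pi * (k - s) = k * (2 * Real.pi) + -(2 * Real.pi * s) by ring,
      AddCircle.coe_add, h, zero_add, AddCircle.coe_neg]
  rw [← hc]
  by_cases hk : (k : ℝ) - s ∈ Ioc (-(1 / 2) : ℝ) (1 / 2)
  · have hmem : 2 * Real.pi * (k - s) ∈ Ioc (-Real.pi) Real.pi := by
      constructor <;> nlinarith [hk.1, hk.2]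
    rw [rep_coe hmem, mul_div_cancel_left₀ _ (by positivity), sub_add_cancel,
      indicator_of_mem (mem_singleton _), g, indicator_of_mem hk, Pi.one_apply, one_mul,
      ← ENNReal.ofReal_div_of_pos (by positivity), mul_div_cancel_left₀ _ (by positivity)]
  · rw [g, indicator_of_notMem hk, indicator_of_notMem, zero_mul, ENNReal.ofReal_zero,
      ENNReal.zero_div]
    intro h
    rw [mem_singleton_iff] at h
    have hm := rep_mem ((2 * Real.pi * (k - s) : ℝ) : Torus)
    have e : rep ((2 * Real.pi * (k - s) : ℝ) : Torus) = 2 * Real.pi * (k - s) := by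
      field_simp at h ⊢
      linarith
    rw [e] at hm
    refine hk ⟨?_, ?_⟩
    · have := hm.1
      nlinarith
    · have := hm.2
      nlinarith

/-- The weight of the closed chains whose winding number is `k`. -/
lemma lintegral_winding (J σ : ℝ) {N : ℕ} (hN : 2 ≤ N) (k : ℤ) :
    ∫⁻ x : Fin N → Torus, ({(k : ℝ)} : Set ℝ).indicator (1 : ℝ → ENNReal)
        (∑ i, rep (incr x i) / (2 * Real.pi)) *
        ∏ i, ENNReal.ofReal (stepDensity J σ (incr x i)) =
      ENNReal.ofReal (convPow (g J σ) N k) := by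
  obtain ⟨n, rfl⟩ := Nat.exists_eq_add_of_le' (show 1 ≤ N by omega)
  have hn : 1 ≤ n := by omega
  have hpi := Real.pi_pos
  have hrep := measurable_rep
  have hstep := (continuous_stepDensity J σ).measurable
  have hone : Measurable (({(k : ℝ)} : Set ℝ).indicator (1 : ℝ → ENNReal)) :=
    measurable_one.indicator (measurableSet_singleton _)
  have h := lintegral_chain J σ hn
    (F := fun a z s => ({(k : ℝ)} : Set ℝ).indicator (1 : ℝ → ENNReal)
      (rep (a - z) / (2 * Real.pi) + s) * ENNReal.ofReal (stepDensity J σ (a - z)))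
    (by refine (hone.comp ?_).mul ?_ <;> fun_prop)
  simp only [sub_add_cancel_left, indicator_closing_eq] at h
  simp only [incr, Fin.sum_univ_succ, Fin.prod_univ_succ, finRotate_symm_zero,
    finRotate_symm_succ, ← mul_assoc]
  rw [h, lintegral_const, ofReal_convPow_succ J σ hn, AddCircle.measure_univ,
    ← lintegral_mul_const' _ _ ENNReal.ofReal_ne_top]
  refine lintegral_congr fun s => ?_
  rw [mul_comm (ENNReal.ofReal (convPow (g J σ) n s)), mul_right_comm,
    ENNReal.div_mul_cancel (by simpa using hpi) ENNReal.ofReal_ne_top]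

/-- The winding number is an integer, since the increments of a closed chain add up to zero. -/
lemma exists_sum_rep_eq {N : ℕ} (x : Fin N → Torus) :
    ∃ k : ℤ, ∑ i, rep (incr x i) / (2 * Real.pi) = k := by
  have h : ((∑ i, rep (incr x i) : ℝ) : Torus) = 0 := by
    have e : ((∑ i, rep (incr x i) : ℝ) : Torus) = ∑ i, ((rep (incr x i) : ℝ) : Torus) :=
      map_sum (QuotientAddGroup.mk' (AddSubgroup.zmultiples (2 * Real.pi)))
        (fun i => rep (incr x i)) Finset.univ
    rw [e]
    simp only [coe_rep, incr]
    rw [Finset.sum_sub_distrib, Equiv.sum_comp (finRotate N).symm x, sub_self]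
  obtain ⟨k, hk⟩ := (AddCircle.coe_eq_zero_iff _).1 h
  refine ⟨k, ?_⟩
  rw [← Finset.sum_div, ← hk, zsmul_eq_mul, mul_div_cancel_right₀ _ Real.two_pi_pos.ne']

/-- The total weight of the closed chains. -/
lemma lintegral_prod_stepDensity (J σ : ℝ) {N : ℕ} (hN : 2 ≤ N) :
    ∫⁻ x : Fin N → Torus, ∏ i, ENNReal.ofReal (stepDensity J σ (incr x i)) =
      ∑' k : ℤ, ENNReal.ofReal (convPow (g J σ) N k) := by
  have hrep := measurable_rep
  have hstep := (continuous_stepDensity J σ).measurable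
  have hincr := @measurable_incr N
  have hone : ∀ k : ℤ, Measurable (({(k : ℝ)} : Set ℝ).indicator (1 : ℝ → ENNReal)) :=
    fun k => measurable_one.indicator (measurableSet_singleton _)
  simp only [← lintegral_winding J σ hN]
  rw [← lintegral_tsum]
  · refine lintegral_congr fun x => ?_
    obtain ⟨k, hk⟩ := exists_sum_rep_eq x
    rw [ENNReal.tsum_mul_right, hk, tsum_eq_single k]
    · rw [indicator_of_mem (mem_singleton _), Pi.one_apply, one_mul]
    · intro j hj
      refine indicator_of_notMem (fun h => hj ?_) _
      exact_mod_cast (mem_singleton_iff.1 h).symm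
  · intro k
    refine Measurable.aemeasurable (((hone k).comp ?_).mul ?_) <;> fun_prop

instance nullSingletonClass_volume_torus : NullSingletonClass (volume : Measure Torus) where
  measure_singleton c := by
    have h := (AddCircle.measurePreserving_mk (2 * Real.pi) (-Real.pi)).measure_preimage
      (measurableSet_singleton c).nullMeasurableSet
    rw [← h, Measure.restrict_apply
      ((measurableSet_singleton c).preimage AddCircle.measurable_mk')]
    refine measure_mono_null (t := {rep c}) ?_ (measure_singleton _)
    rintro a ⟨ha, ha'⟩
    rw [mem_preimage, mem_singleton_iff] at ha
    rw [mem_singleton_iff, ← ha]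
    exact (rep_coe ⟨ha'.1, ha'.2.trans_eq (by ring)⟩).symm

/-- The condition in `windingEq` that no increment is `π` excludes a null set only. For `N = 1`
the only increment is `0`. -/
lemma ae_incr_ne {N : ℕ} (hN : 2 ≤ N) (i : Fin N) (c : Torus) :
    ∀ᵐ x : Fin N → Torus, incr x i ≠ c := by
  obtain ⟨n, rfl⟩ := Nat.exists_eq_add_of_le' (show 1 ≤ N by omega)
  have hne : (finRotate (n + 1)).symm i ≠ i := by
    intro h
    rw [Equiv.symm_apply_eq, finRotate_apply] at h
    have : (1 : Fin (n + 1)) = 0 := by simpa using h.symm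
    have h1 := congrArg Fin.val this
    rw [Fin.val_one', Fin.val_zero, Nat.mod_eq_of_lt (by omega)] at h1
    omega
  obtain ⟨j, hj⟩ := Fin.exists_succAbove_eq hne
  have hmp := volume_preserving_piFinSuccAbove (fun _ : Fin (n + 1) => Torus) i
  have h : ∀ᵐ p : Torus × (Fin n → Torus), p.1 - p.2 j ≠ c := by
    rw [ae_iff, Measure.volume_eq_prod, Measure.measure_prod_null]
    · refine Eventually.of_forall fun a => ?_
      have e : Prod.mk a ⁻¹' {p : Torus × (Fin n → Torus) | ¬p.1 - p.2 j ≠ c} =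
          {q : Fin n → Torus | q j = a - c} := by
        ext q
        simp only [mem_preimage, mem_ofPred_eq, not_not]
        constructor <;> intro h
        · rw [← h]; abel
        · rw [h]; abel
      change volume (Prod.mk a ⁻¹' {p : Torus × (Fin n → Torus) | ¬p.1 - p.2 j ≠ c}) = 0
      rw [e]
      exact Measure.pi_hyperplane (fun _ : Fin n => (volume : Measure Torus)) j (a - c)
    · simp only [not_not]
      exact (measurableSet_singleton c).preimage
        (f := fun p : Torus × (Fin n → Torus) => p.1 - p.2 j) (by fun_prop)
  filter_upwards [hmp.quasiMeasurePreserving.ae h] with x hx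
  rw [incr, ← hj]
  exact hx

lemma measurableSet_windingEq (N : ℕ) (k : ℤ) : MeasurableSet (windingEq N k) := by
  have hrep := measurable_rep
  have hincr := @measurable_incr N
  have h1 : MeasurableSet {x : Fin N → Torus | ∀ i, incr x i ≠ ((Real.pi : ℝ) : Torus)} := by
    rw [ofPred_forall]
    exact MeasurableSet.iInter fun i => ((measurableSet_singleton _).preimage (hincr i)).compl
  exact h1.inter ((measurableSet_singleton (k : ℝ)).preimage
      (f := fun x : Fin N → Torus => 1 / (2 * Real.pi) * ∑ i, rep (incr x i)) (by fun_prop))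

lemma exp_hamiltonian_eq (J σ : ℝ) {N : ℕ} (x : Fin N → Torus) :
    Real.exp (-(1 / (2 * σ ^ 2)) * hamiltonian J x) =
      normConst J σ ^ N * ∏ i, stepDensity J σ (incr x i) := by
  have hm := normConst_pos J σ
  unfold stepDensity hamiltonian
  rw [Finset.prod_mul_distrib, Finset.prod_const, Finset.card_univ, Fintype.card_fin,
    ← Real.exp_sum, ← mul_assoc (normConst J σ ^ N), ← mul_pow, mul_one_div_cancel hm.ne',
    one_pow, one_mul,
    ← Finset.mul_sum]
  congr 1
  ring

/-- The winding number has the law of the sum of independent increments with density `g`,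
conditioned to be an integer. -/
lemma gibbs_real_windingEq (J σ : ℝ) {N : ℕ} (hN : 2 ≤ N) (k : ℤ)
    (hs : Summable fun j : ℤ => convPow (g J σ) N j) :
    (gibbs J σ N).real (windingEq N k) =
      convPow (g J σ) N k / ∑' j : ℤ, convPow (g J σ) N j := by
  have hm := normConst_pos J σ
  have hN1 : 1 ≤ N := by omega
  have hnn : ∀ y, 0 ≤ convPow (g J σ) N y := convPow_nonneg (g_nonneg J σ) hN1
  have hpos : ∀ x : Fin N → Torus, 0 ≤ ∏ i, stepDensity J σ (incr x i) :=
    fun x => Finset.prod_nonneg fun i _ => (stepDensity_pos J σ _).le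
  have hW : ∀ x : Fin N → Torus, ENNReal.ofReal (∏ i, stepDensity J σ (incr x i)) =
      ∏ i, ENNReal.ofReal (stepDensity J σ (incr x i)) :=
    fun x => ENNReal.ofReal_prod_of_nonneg fun i _ => (stepDensity_pos J σ _).le
  have hcont : Continuous fun x : Fin N → Torus => ∏ i, stepDensity J σ (incr x i) := by
    have := continuous_stepDensity J σ
    unfold incr
    fun_prop
  set Z := ∫ x : Fin N → Torus, ∏ i, stepDensity J σ (incr x i) with hZ
  have hZeq : Z = ∑' j : ℤ, convPow (g J σ) N j := by
    rw [hZ, integral_eq_lintegral_of_nonneg_ae (Eventually.of_forall hpos)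
      hcont.aestronglyMeasurable]
    simp only [hW]
    rw [lintegral_prod_stepDensity J σ hN, ← ENNReal.ofReal_tsum_of_nonneg (fun j : ℤ => hnn j) hs,
      ENNReal.toReal_ofReal (tsum_nonneg fun j : ℤ => hnn j)]
  have hset : ∀ᵐ x : Fin N → Torus, (windingEq N k).indicator
      (fun x => ENNReal.ofReal (∏ i, stepDensity J σ (incr x i))) x =
      ({(k : ℝ)} : Set ℝ).indicator (1 : ℝ → ENNReal) (∑ i, rep (incr x i) / (2 * Real.pi)) *
        ∏ i, ENNReal.ofReal (stepDensity J σ (incr x i)) := by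
    filter_upwards [ae_all_iff.2 fun i => ae_incr_ne hN i ((Real.pi : ℝ) : Torus)] with x hx
    have e : ∑ i, rep (incr x i) / (2 * Real.pi) = 1 / (2 * Real.pi) * ∑ i, rep (incr x i) := by
      rw [← Finset.sum_div]; ring
    by_cases h : x ∈ windingEq N k
    · rw [indicator_of_mem h, e, indicator_of_mem (by exact h.2), Pi.one_apply, one_mul, hW]
    · have h' : 1 / (2 * Real.pi) * ∑ i, rep (incr x i) ∉ ({(k : ℝ)} : Set ℝ) :=
        fun h' => h ⟨hx, h'⟩
      rw [indicator_of_notMem h, e, indicator_of_notMem h', zero_mul]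
  have hset2 : ∫⁻ x in windingEq N k, ENNReal.ofReal (∏ i, stepDensity J σ (incr x i)) =
      ENNReal.ofReal (convPow (g J σ) N k) := by
    rw [← lintegral_winding J σ hN k, ← lintegral_indicator (measurableSet_windingEq N k)]
    exact lintegral_congr_ae hset
  have hint := (ENNReal.toReal_ofReal (hnn k))
  rw [Measure.real, gibbs, tilted_apply' _ _ (measurableSet_windingEq N k)]
  simp only [exp_hamiltonian_eq]
  rw [integral_const_mul, ← hZ]
  simp only [mul_div_mul_left _ _ (pow_pos hm N).ne', div_eq_mul_inv]
  simp only [ENNReal.ofReal_mul (hpos _)]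
  rw [lintegral_mul_const' _ _ ENNReal.ofReal_ne_top, hset2, ENNReal.toReal_mul, hint,
    ENNReal.toReal_ofReal (inv_nonneg.2 (by rw [hZ]; exact integral_nonneg hpos)), hZeq]

/-! ### The conclusion -/

lemma summable_convPow_int (J σ : ℝ) {N : ℕ} (hN : 1 ≤ N) :
    Summable fun j : ℤ => convPow (g J σ) N j := by
  have h := summable_of_isBigO (Real.summable_abs_int_rpow one_lt_two)
    ((isBigO_cocompact_convPow J σ hN).comp_tendsto Int.tendsto_coe_cofinite)
  exact Complex.summable_ofReal.1 h

lemma sqrt_div_mul_rpow {J σ : ℝ} (hσ : 0 < σ) (M : ℕ) :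
    √J / σ * (M : ℝ) ^ (-(1 / 2) : ℝ) = √2 * √(J / (2 * σ ^ 2) / M) := by
  rw [← Real.sqrt_mul (by norm_num), Real.rpow_neg (by positivity), ← Real.sqrt_eq_rpow,
    ← div_eq_mul_inv]
  rw [show 2 * (J / (2 * σ ^ 2) / M) = J / σ ^ 2 / M by field_simp,
    Real.sqrt_div' _ (by positivity), Real.sqrt_div' _ (by positivity), Real.sqrt_sq hσ.le]

end

end RotorChain

open RotorChain in
theorem mainTheorem4 (k : ℤ) :
    ∃ c C : ℝ, 0 < c ∧ 0 < C ∧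
      ∀ J σ : ℕ → ℝ, (∀ N, 0 < σ N) →
        Tendsto (fun N => J N / σ N ^ 2) atTop atTop →
        (fun N => J N / σ N ^ 2) =o[atTop] (fun N => (N : ℝ)) →
        ∀ᶠ N : ℕ in atTop,
          (∀ M : ℕ, (N : ℝ) / 2 ≤ (M : ℝ) → ∀ y ∈ Icc ((k : ℝ) - 1) ((k : ℝ) + 1),
            c * (√(J N) / σ N) * (M : ℝ) ^ (-(1 / 2) : ℝ)
                ≤ RotorChain.convPow (RotorChain.g (J N) (σ N)) M y ∧
            RotorChain.convPow (RotorChain.g (J N) (σ N)) M y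
                ≤ C * (√(J N) / σ N) * (M : ℝ) ^ (-(1 / 2) : ℝ)) ∧
          c * (√(J N) / σ N) * (N : ℝ) ^ (-(1 / 2) : ℝ)
              ≤ (RotorChain.gibbs (J N) (σ N) N).real (RotorChain.windingEq N k) ∧
          (RotorChain.gibbs (J N) (σ N) N).real (RotorChain.windingEq N k)
              ≤ C * (√(J N) / σ N) * (N : ℝ) ^ (-(1 / 2) : ℝ) := by
  obtain ⟨S, hS, hsum⟩ := exists_abs_tsum_convPow_sub_one_le
  refine ⟨1 / 100, 40, by norm_num, by norm_num, fun J σ hσ hlarge hsmall => ?_⟩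
  set A : ℝ := 2 * Real.pi * 4000 * (|(k : ℝ)| + 1) with hA
  have hA0 : 0 < A := by positivity
  -- `1 / S` controls the normalization, `1 / A ^ 2` the cosine in the inversion integral.
  set ε : ℝ := min (1 / S) (1 / A ^ 2) with hε
  have hε0 : 0 < ε := by positivity
  filter_upwards [hlarge.eventually_ge_atTop 6, hsmall.def hε0,
    eventually_ge_atTop (2 * (15 * 4000 ^ 2))] with N hN1 hN2 hN3
  have hσN := hσ N
  have hb2 : J N / (2 * σ N ^ 2) = J N / σ N ^ 2 / 2 := by field_simp
  have hb : 3 ≤ J N / (2 * σ N ^ 2) := by rw [hb2]; linarith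
  rw [Real.norm_of_nonneg (by linarith), Real.norm_of_nonneg (by positivity)] at hN2
  have hNpos : (0 : ℝ) < N := by
    have : 0 < N := by omega
    exact_mod_cast this
  have h2a : 1 ≤ √(2 : ℝ) := Real.one_le_sqrt.2 (by norm_num)
  have h2b : √(2 : ℝ) ≤ 2 := Real.sqrt_le_iff.2 ⟨by norm_num, by norm_num⟩
  have hmain : ∀ M : ℕ, (N : ℝ) / 2 ≤ (M : ℝ) → ∀ y ∈ Icc ((k : ℝ) - 1) ((k : ℝ) + 1),
      1 / 24 * √(J N / (2 * σ N ^ 2) / M) ≤ convPow (g (J N) (σ N)) M y ∧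
        convPow (g (J N) (σ N)) M y ≤ 20 * √(J N / (2 * σ N ^ 2) / M) := by
    intro M hM y hy
    have hM15 : 15 * 4000 ^ 2 ≤ M := by
      have h1 : ((2 * (15 * 4000 ^ 2) : ℕ) : ℝ) ≤ N := by exact_mod_cast hN3
      push_cast at h1
      have h2 : (15 * 4000 ^ 2 : ℝ) ≤ M := by linarith
      exact_mod_cast h2
    have hMpos : (0 : ℝ) < M := by linarith
    refine ⟨le_convPow hb hM15 ?_, convPow_le hb (by omega) y⟩
    have hu : √(J N / (2 * σ N ^ 2) / M) ≤ 1 / A := by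
      refine Real.sqrt_le_iff.2 ⟨by positivity, ?_⟩
      rw [div_le_iff₀ hMpos, hb2, div_pow, one_pow]
      have h1 : ε * N ≤ 1 / A ^ 2 * N := mul_le_mul_of_nonneg_right (min_le_right _ _) hNpos.le
      have h2 : 1 / A ^ 2 * (N / 2) ≤ 1 / A ^ 2 * M := mul_le_mul_of_nonneg_left hM (by positivity)
      linarith
    have hyk : |y| ≤ |(k : ℝ)| + 1 := by
      rw [abs_le]
      constructor <;> linarith [hy.1, hy.2, le_abs_self (k : ℝ), neg_abs_le (k : ℝ)]
    calc 2 * Real.pi * 4000 * √(J N / (2 * σ N ^ 2) / M) * |y|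
        ≤ 2 * Real.pi * 4000 * (1 / A) * (|(k : ℝ)| + 1) := by gcongr
      _ = A * (1 / A) := by rw [hA]; ring
      _ = 1 := mul_one_div_cancel hA0.ne'
  refine ⟨fun M hM y hy => ?_, ?_⟩
  · obtain ⟨h1, h2⟩ := hmain M hM y hy
    rw [mul_assoc, mul_assoc, sqrt_div_mul_rpow hσN]
    have hq := Real.sqrt_nonneg (J N / (2 * σ N ^ 2) / M)
    constructor <;> nlinarith
  · obtain ⟨h1, h2⟩ := hmain N (by linarith) k ⟨by linarith, by linarith⟩
    rw [mul_assoc, mul_assoc, sqrt_div_mul_rpow hσN,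
      gibbs_real_windingEq _ _ (by omega) k (summable_convPow_int _ _ (by omega))]
    have hq := Real.sqrt_nonneg (J N / (2 * σ N ^ 2) / N)
    have hZ := hsum (J N) (σ N) hb N (by omega)
    have hZ2 : S * (J N / (2 * σ N ^ 2) / N) ≤ 1 / 2 := by
      have h3 : J N / σ N ^ 2 ≤ 1 / S * N :=
        hN2.trans (mul_le_mul_of_nonneg_right (min_le_left _ _) hNpos.le)
      have h4 : J N / σ N ^ 2 / N ≤ 1 / S := by rwa [div_le_iff₀ hNpos]
      have h5 := mul_le_mul_of_nonneg_left h4 hS.le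
      rw [mul_one_div_cancel hS.ne'] at h5
      rw [hb2, div_right_comm]
      linarith
    obtain ⟨hZ3, hZ4⟩ := abs_le.1 (hZ.trans hZ2)
    constructor
    · rw [le_div_iff₀ (by linarith)]
      nlinarith [mul_nonneg (Real.sqrt_nonneg 2) hq]
    · rw [div_le_iff₀ (by linarith)]
      nlinarith [mul_nonneg (Real.sqrt_nonneg 2) hq]
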